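/- Let $X$ be a real Banach space with an unconditional basis $(e_\gamma)_{\gamma\in\Gamma}$, where $\Gamma$ is an arbitrary (possibly uncountable) set. That is, there are $f_\gamma\in X^*$ with $f_\gamma(e_\delta)=1$ if $\gamma=\delta$ and $f_\gamma(e_\delta)=0$ otherwise, such that every $x\in X$ is the unconditional sum $x=\sum_{\gamma\in\Gamma}f_\gamma(x)e_\gamma$. If $X$ admits an equivalent Fréchet smooth norm, then $X$ admits an equivalent norm whose dual norm on $X^*$ is locally uniformly rotund (LUR). Here a norm $\|\cdot\|$ on $X$ is Fréchet smooth if, for every $x\neq 0$, $$\lim_{t\to 0}\frac{\|x+th\|+\|x-th\|-2\|x\|}{t}=0$$ uniformly for $h$ in the unit sphere $\{h\in X:\|h\|=1\}$. The norm dual to $\|\cdot\|$ is $\|f\|^*=\sup\{|f(x)|:\|x\|\le 1\}$ for $f\in X^*$. A norm $N$ on a vector space $E$ is LUR if, whenever $x\in E$ and $(x_n)$ is a sequence in $E$ with $N(x)=N(x_n)=1$ for all $n$ and $N(x+x_n)\to 2$, we have $N(x-x_n)\to 0$. -/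

import Mathlib

open Filter Topology

/-- The seminorm `p` is an equivalent norm on the normed space `X`. -/
def IsEquivalentNorm {X : Type*} [NormedAddCommGroup X] [NormedSpace ℝ X]
    (p : Seminorm ℝ X) : Prop :=
  ∃ c C : ℝ, 0 < c ∧ 0 < C ∧ ∀ x : X, c * ‖x‖ ≤ p x ∧ p x ≤ C * ‖x‖

/-- Fréchet smoothness of a norm `p`: for every nonzero `x`, the symmetric difference quotient
`(p (x + t h) + p (x - t h) - 2 p x) / t` tends to `0` as `t → 0` (`t ≠ 0`), uniformly for `h` in
the unit sphere of `p`. -/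
def IsFrechetSmooth {X : Type*} [AddCommGroup X] [Module ℝ X] (p : Seminorm ℝ X) : Prop :=
  ∀ x : X, x ≠ 0 →
    TendstoUniformlyOn (fun (t : ℝ) (h : X) => (p (x + t • h) + p (x - t • h) - 2 * p x) / t)
      (fun _ => 0) (𝓝[≠] (0 : ℝ)) {h : X | p h = 1}

/-- The norm on the topological dual of `X` that is dual to the norm `p` on `X`:
`f ↦ sup {|f x| : p x ≤ 1}`. The supremum is finite as soon as `p` is an equivalent norm. -/
noncomputable def dualNorm {X : Type*} [NormedAddCommGroup X] [NormedSpace ℝ X]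
    (p : Seminorm ℝ X) (f : StrongDual ℝ X) : ℝ :=
  sSup {r : ℝ | ∃ x : X, p x ≤ 1 ∧ r = |f x|}

/-- A norm `N` is locally uniformly rotund (LUR) if `N x = N (u n) = 1` for all `n` together with
`N (x + u n) → 2` implies `N (x - u n) → 0`. -/
def IsLUR {E : Type*} [AddCommGroup E] (N : E → ℝ) : Prop :=
  ∀ (x : E) (u : ℕ → E), N x = 1 → (∀ n, N (u n) = 1) →
    Tendsto (fun n => N (x + u n)) atTop (𝓝 2) →
    Tendsto (fun n => N (x - u n)) atTop (𝓝 0)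

/-! The proof has two independent halves.

Smoothness makes the basis shrinking: the tails `f ∘ (1 - P_A)` of every functional `f` tend to zero
in norm. Otherwise the seminorm `R x = ∑ |f_γ(x) f(e_γ)|` is uniformly rough: at each `x` some
direction `h`, supported where `x` has almost no mass, gives `R (x + t h) + R (x - t h) - 2 R x ≥ δ
t`. But `p ^ 2 - R` is bounded below, and at an almost-minimum in Ekeland's sense the smoothness of
`p ^ 2` passes to `R` up to a small multiple of `t` (`IsFrechetSmooth.exists_not_rough`).

A basis with vanishing tails gives a dual LUR norm. The square of the new dual norm is a weighted
sum of the gauges `cardGauge n k`, and weak-star lower semicontinuity ensures that it is a dual norm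
(`IsQuadraticGauge.exists_dualNorm_sq`). An LUR test sequence `u` at `f` forces asymptotic equality
in the midpoint convexity of every summand. Take a finite set `A` on which `|f|` exceeds its values
off `A` by a gap and off which `f` has small tail (`exists_gap`). For `n = |A|` and large `k`, the
gap lets only `A` almost attain the supremum at the midpoint. Then `setGauge_combo` makes `u m`
close to `f` on `A` and the tail norms of `u m` and `f` close; as the tail of `f` is small, so is
that of `u m`. -/

/-! ### Variational principle and non-roughness -/

/-- **Ekeland's variational principle** for a continuous function that is bounded below. -/
theorem exists_forall_le_add_norm_sub {X : Type*} [NormedAddCommGroup X] [CompleteSpace X]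
    {F : X → ℝ} (hF : Continuous F) {m : ℝ} (hm : ∀ x, m ≤ F x) {l : ℝ} (hl : 0 < l) :
    ∃ x, ∀ y, F x ≤ F y + l * ‖y - x‖ := by
  -- Choose `z` almost minimizing `F` over the points that improve on `x` by at least `l` times
  -- their distance from `x`.
  have step : ∀ (n : ℕ) (x : X), ∃ z, F z + l * ‖z - x‖ ≤ F x ∧
      ∀ y, F y + l * ‖y - x‖ ≤ F x → F z ≤ F y + (1 / 2 : ℝ) ^ n := by
    intro n x
    let S : Set ℝ := F '' {y | F y + l * ‖y - x‖ ≤ F x}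
    have hne : S.Nonempty := ⟨F x, x, by simp, rfl⟩
    have hbdd : BddBelow S := ⟨m, by rintro _ ⟨y, -, rfl⟩; exact hm y⟩
    obtain ⟨_, ⟨z, hz, rfl⟩, hlt⟩ := exists_lt_of_csInf_lt hne
      (lt_add_of_pos_right (sInf S) (by positivity : (0 : ℝ) < (1 / 2) ^ n))
    refine ⟨z, hz, fun y hy => hlt.le.trans ?_⟩
    gcongr
    exact csInf_le hbdd ⟨y, hy, rfl⟩
  choose g hg1 hg2 using step
  let u : ℕ → X := fun n => Nat.rec 0 (fun n x => g n x) n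
  have hu : ∀ n, u (n + 1) = g n (u n) := fun n => rfl
  have hdist : ∀ n k, F (u (n + k)) + l * ‖u (n + k) - u n‖ ≤ F (u n) := by
    intro n k
    induction k with
    | zero => simp
    | succ k ih =>
      have h1 := hg1 (n + k) (u (n + k))
      rw [← hu] at h1
      have h2 : ‖u (n + k + 1) - u n‖ ≤ ‖u (n + k + 1) - u (n + k)‖ + ‖u (n + k) - u n‖ :=
        norm_sub_le_norm_sub_add_norm_sub _ _ _
      have h3 := mul_le_mul_of_nonneg_left h2 hl.le
      rw [← add_assoc]
      linarith
  have hanti : Antitone (fun n => F (u n)) := antitone_nat_of_succ_le fun n => by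
    have h1 := hdist n 1
    have h2 : 0 ≤ l * ‖u (n + 1) - u n‖ := by positivity
    linarith
  have hconv : Tendsto (fun n => F (u n)) atTop (𝓝 (⨅ n, F (u n))) :=
    tendsto_atTop_ciInf hanti ⟨m, by rintro _ ⟨n, rfl⟩; exact hm _⟩
  have hcau : CauchySeq u := by
    rw [Metric.cauchySeq_iff']
    intro ε hε
    obtain ⟨N, hN⟩ := Metric.cauchySeq_iff'.1 hconv.cauchySeq (l * ε) (by positivity)
    refine ⟨N, fun n hn => ?_⟩
    obtain ⟨k, rfl⟩ := Nat.exists_eq_add_of_le hn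
    have h1 := hdist N k
    have h2 := hN (N + k) hn
    rw [Real.dist_eq, abs_sub_comm] at h2
    rw [dist_eq_norm]
    exact lt_of_mul_lt_mul_left (by linarith [le_abs_self (F (u N) - F (u (N + k)))]) hl.le
  obtain ⟨x, hx⟩ := cauchySeq_tendsto_of_complete hcau
  have hxF : Tendsto (fun n => F (u n)) atTop (𝓝 (F x)) := (hF.tendsto x).comp hx
  have hxS : ∀ n, F x + l * ‖x - u n‖ ≤ F (u n) := by
    intro n
    have h1 : Tendsto (fun k => F (u k) + l * ‖u k - u n‖) atTop (𝓝 (F x + l * ‖x - u n‖)) :=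
      hxF.add (((hx.sub_const _).norm).const_mul _)
    refine le_of_tendsto h1 (eventually_atTop.2 ⟨n, fun k hk => ?_⟩)
    obtain ⟨j, rfl⟩ := Nat.exists_eq_add_of_le hk
    exact hdist n j
  refine ⟨x, fun y => ?_⟩
  by_contra! hy
  -- A violating `y` is admissible at every stage, so almost minimality yields `F x ≤ F y` in the
  -- limit.
  have hle : ∀ n, F (u (n + 1)) ≤ F y + (1 / 2 : ℝ) ^ n := by
    intro n
    rw [hu]
    refine hg2 n (u n) y ?_
    have h2 : ‖y - u n‖ ≤ ‖y - x‖ + ‖x - u n‖ := norm_sub_le_norm_sub_add_norm_sub _ _ _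
    have h3 := mul_le_mul_of_nonneg_left h2 hl.le
    linarith [hxS n]
  have hlim : Tendsto (fun n : ℕ => F y + (1 / 2 : ℝ) ^ n) atTop (𝓝 (F y + 0)) :=
    tendsto_const_nhds.add (tendsto_pow_atTop_nhds_zero_of_lt_one (by norm_num) (by norm_num))
  have := le_of_tendsto_of_tendsto' (hxF.comp (tendsto_add_atTop_nat 1)) hlim hle
  have h2 : 0 ≤ l * ‖y - x‖ := by positivity
  linarith

/-- A space with an equivalent Fréchet smooth norm carries no uniformly rough continuous
seminorm. -/
theorem IsFrechetSmooth.exists_not_rough {X : Type*} [NormedAddCommGroup X] [NormedSpace ℝ X]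
    [CompleteSpace X] {p : Seminorm ℝ X} (hp : IsEquivalentNorm p) (hs : IsFrechetSmooth p)
    {R : Seminorm ℝ X} {M : ℝ} (hM : ∀ x, R x ≤ M * ‖x‖) {ε : ℝ} (hε : 0 < ε) :
    ∃ (x : X) (t : ℝ), 0 < t ∧
      ∀ h, p h = 1 → R (x + t • h) + R (x - t • h) - 2 * R x < ε * t := by
  obtain ⟨c, C, hc, hC, hcC⟩ := hp
  have lip : ∀ (q : Seminorm ℝ X) (K : ℝ), (∀ x, q x ≤ K * ‖x‖) → Continuous q := by
    intro q K hK
    refine (LipschitzWith.of_dist_le_mul (K := K.toNNReal) fun x y => ?_).continuous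
    rw [Real.dist_eq, dist_eq_norm]
    refine (abs_sub_map_le_sub q x y).trans ((hK _).trans ?_)
    gcongr
    exact Real.le_coe_toNNReal K
  have hFc : Continuous fun x => p x ^ 2 - R x :=
    ((lip p C fun x => (hcC x).2).pow 2).sub (lip R M hM)
  have hbelow : ∀ x, -(M / c) ^ 2 ≤ p x ^ 2 - R x := by
    intro x
    have h1 : R x ≤ |M / c| * p x := by
      calc R x ≤ M * ‖x‖ := hM x
        _ ≤ |M| * ‖x‖ := by gcongr; exact le_abs_self M
        _ = |M / c| * (c * ‖x‖) := by rw [abs_div, abs_of_pos hc]; field_simp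
        _ ≤ _ := by gcongr; exact (hcC x).1
    rw [← sq_abs (M / c)]
    nlinarith [sq_nonneg (p x - |M / c|), sq_nonneg (p x), sq_nonneg (|M / c|)]
  -- Since `‖h‖ ≤ 1 / c` when `p h = 1`, the slope `c * ε / 4` costs at most `ε / 4 * t` in each of
  -- the directions `h` and `-h`.
  obtain ⟨x, hx⟩ := exists_forall_le_add_norm_sub hFc hbelow
    (by positivity : 0 < c * ε / 4)
  refine ⟨x, ?_⟩
  have hnorm : ∀ h, p h = 1 → ‖h‖ ≤ 1 / c := fun h hh => by
    rw [le_div_iff₀ hc, mul_comm, ← hh]; exact (hcC h).1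
  have key : ∀ t : ℝ, 0 < t → ∀ h, p h = 1 → R (x + t • h) + R (x - t • h) - 2 * R x ≤
      p (x + t • h) ^ 2 + p (x - t • h) ^ 2 - 2 * p x ^ 2 + ε / 2 * t := by
    intro t ht h hh
    have h1 := hx (x + t • h)
    have h2 := hx (x - t • h)
    have h3 : c * ε / 4 * (t * ‖h‖) ≤ ε / 4 * t := by
      calc c * ε / 4 * (t * ‖h‖) ≤ c * ε / 4 * (t * (1 / c)) := by gcongr; exact hnorm h hh
        _ = _ := by field_simp
    rw [add_sub_cancel_left, norm_smul, Real.norm_of_nonneg ht.le] at h1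
    rw [sub_sub_cancel_left, norm_neg, norm_smul, Real.norm_of_nonneg ht.le] at h2
    linarith
  -- Write `a ^ 2 - b ^ 2 = (a - b) ^ 2 + 2 * b * (a - b)` with `b = p x`: the squares contribute at
  -- most `2 * t ^ 2`, the linear terms at most `2 * η * p x * t`.
  have hsmall : ∀ η : ℝ, 0 < η → ∀ t : ℝ, 0 < t → (∀ h, p h = 1 →
      p (x + t • h) + p (x - t • h) - 2 * p x ≤ η * t) → t < ε / 8 → η * p x ≤ ε / 16 →
      ∀ h, p h = 1 → R (x + t • h) + R (x - t • h) - 2 * R x < ε * t := by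
    intro η hη t ht hh ht' hη' h hp1
    have h1 : |p (x + t • h) - p x| ≤ t := by
      have := abs_sub_map_le_sub p (x + t • h) x
      rwa [add_sub_cancel_left, map_smul_eq_mul, hp1, Real.norm_of_nonneg ht.le, mul_one] at this
    have h2 : |p (x - t • h) - p x| ≤ t := by
      have := abs_sub_map_le_sub p (x - t • h) x
      rwa [sub_sub_cancel_left, map_neg_eq_map, map_smul_eq_mul, hp1, Real.norm_of_nonneg ht.le,
        mul_one] at this
    have h3 := sq_le_sq' (abs_le.1 h1).1 (abs_le.1 h1).2
    have h4 := sq_le_sq' (abs_le.1 h2).1 (abs_le.1 h2).2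
    have h5 := mul_le_mul_of_nonneg_left (hh h hp1) (apply_nonneg p x)
    have h6 := mul_le_mul_of_nonneg_right hη' ht.le
    have h7 := mul_lt_mul_of_pos_right ht' ht
    have h8 := key t ht h hp1
    have h9 : 0 < ε * t := by positivity
    nlinarith
  -- At the origin `p` is not smooth but `p ^ 2` is: `η = 2` works because `p x = 0`.
  by_cases hx0 : x = 0
  · refine ⟨ε / 16, by positivity, hsmall 2 two_pos _ (by positivity) (fun h hh => ?_)
      (by linarith) (by simp [hx0]; positivity)⟩
    rw [hx0, zero_add, zero_sub, map_neg_eq_map, map_smul_eq_mul, hh, map_zero,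
      Real.norm_of_nonneg (by positivity)]
    linarith
  · have hpx : 0 < p x := lt_of_lt_of_le (mul_pos hc (norm_pos_iff.2 hx0)) (hcC x).1
    have hη : 0 < ε / (16 * p x) := by positivity
    have h1 := Metric.tendstoUniformlyOn_iff.1 (hs x hx0) _ hη
    have h2 := h1.filter_mono (nhdsWithin_mono 0 (fun t (ht : 0 < t) => ht.ne') :
      𝓝[>] (0 : ℝ) ≤ 𝓝[≠] 0)
    have h3 : ∀ᶠ t in 𝓝[>] (0 : ℝ), t < ε / 8 :=
      nhdsWithin_le_nhds (Iio_mem_nhds (by positivity))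
    obtain ⟨t, ⟨ht1, ht2⟩, ht⟩ := ((h2.and h3).and self_mem_nhdsWithin).exists
    have ht : 0 < t := ht
    refine ⟨t, ht, hsmall _ hη t ht (fun h hh => ?_) ht2 (le_of_eq (by field_simp))⟩
    have := ht1 h hh
    rw [dist_zero_left, Real.norm_eq_abs] at this
    have := (abs_lt.1 this).2.le
    rwa [div_le_iff₀ ht] at this

/-! ### The basis is shrinking -/

namespace GeneralSchauderBasis

variable {X : Type*} [NormedAddCommGroup X] [NormedSpace ℝ X] {Γ : Type*}

/-- The sums `∑ |f (e γ)| |x γ|` over finite sets are bounded by a multiple of `‖x‖`. -/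
theorem sum_abs_le (b : UnconditionalSchauderBasis Γ ℝ X) {K : ℝ} (hK : ∀ A, ‖b.proj A‖ ≤ K)
    (f : StrongDual ℝ X) (x : X) (A : Finset Γ) :
    ∑ i ∈ A, |b.coord i x * f (b i)| ≤ 2 * ‖f‖ * K * ‖x‖ := by
  classical
  have hb : ∀ B, |f (b.proj B x)| ≤ ‖f‖ * K * ‖x‖ := fun B => by
    calc |f (b.proj B x)| ≤ ‖f‖ * ‖b.proj B x‖ := f.le_opNorm _
      _ ≤ ‖f‖ * (K * ‖x‖) := by gcongr; exact (b.proj B).le_of_opNorm_le (hK B) x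
      _ = _ := by ring
  have he : ∀ B, f (b.proj B x) = ∑ i ∈ B, b.coord i x * f (b i) := fun B => by
    simp [GeneralSchauderBasis.proj_apply]
  -- Splitting `A` by sign turns the sum into two values of `f` at projections of `x`, whence the
  -- factor 2.
  rw [← Finset.sum_filter_add_sum_filter_not A (fun i => 0 ≤ b.coord i x * f (b i)),
    Finset.sum_congr rfl (g := fun i => b.coord i x * f (b i)) fun i hi =>
      abs_of_nonneg (Finset.mem_filter.1 hi).2,
    Finset.sum_congr (s₁ := A.filter fun i => ¬ 0 ≤ b.coord i x * f (b i)) rfl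
      (g := fun i => -(b.coord i x * f (b i))) fun i hi =>
      abs_of_neg (not_le.1 (Finset.mem_filter.1 hi).2), Finset.sum_neg_distrib, ← he, ← he]
  have h1 := (abs_le.1 (hb (A.filter fun i => 0 ≤ b.coord i x * f (b i)))).2
  have h2 := (abs_le.1 (hb (A.filter fun i => ¬ 0 ≤ b.coord i x * f (b i)))).1
  linarith

/-- An unconditional basis of a Banach space with an equivalent Fréchet smooth norm is
shrinking. -/
theorem exists_norm_sub_comp_proj_le [CompleteSpace X] (b : UnconditionalSchauderBasis Γ ℝ X)
    {p : Seminorm ℝ X} (hp : IsEquivalentNorm p) (hs : IsFrechetSmooth p)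
    (f : StrongDual ℝ X) {ε : ℝ} (hε : 0 < ε) :
    ∃ A : Finset Γ, ‖f.comp (ContinuousLinearMap.id ℝ X - b.proj A)‖ ≤ ε := by
  classical
  by_contra! hcon
  obtain ⟨K, hK⟩ := UnconditionalSchauderBasis.exists_norm_proj_le b
  have hK0 : 0 ≤ K := (norm_nonneg _).trans (hK ∅)
  have hsum : ∀ x, Summable fun i => |b.coord i x * f (b i)| := fun x =>
    summable_of_sum_le (fun _ => abs_nonneg _) (sum_abs_le b hK f x)
  let R : Seminorm ℝ X := Seminorm.of (fun x => ∑' i, |b.coord i x * f (b i)|)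
    (fun x y => by
      rw [← (hsum x).tsum_add (hsum y)]
      refine (hsum _).tsum_le_tsum (fun i => ?_) ((hsum x).add (hsum y))
      rw [map_add, add_mul]
      exact abs_add_le _ _)
    (fun a x => by
      rw [← tsum_mul_left]
      simp [mul_assoc, abs_mul])
  have hRdef : ∀ x, R x = ∑' i, |b.coord i x * f (b i)| := fun x => rfl
  have hRM : ∀ x, R x ≤ 2 * ‖f‖ * K * ‖x‖ := fun x =>
    Real.tsum_le_of_sum_le (fun _ => abs_nonneg _) (sum_abs_le b hK f x)
  have hRf : ∀ x, |f x| ≤ R x := by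
    intro x
    have h1 : HasSum (fun i => b.coord i x * f (b i)) (f x) := by
      simpa using f.hasSum (b.expansion x)
    rw [← h1.tsum_eq]
    exact norm_tsum_le_tsum_norm (f := fun i => b.coord i x * f (b i)) (hsum x)
  obtain ⟨c, C, hc, hC, hcC⟩ := id hp
  -- This is a lower bound for `R h` below: `|f w| > ε * ‖v‖` while `p w ≤ C * (1 + K) * ‖v‖`.
  have hδ : 0 < ε / (C * (1 + K)) := by positivity
  obtain ⟨x, t, ht, hx⟩ := hs.exists_not_rough hp hRM hδ
  set δ := ε / (C * (1 + K)) with hδ_def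
  obtain ⟨A, hA⟩ := ((tendsto_tsum_compl_atTop_zero fun i => |b.coord i x * f (b i)|).eventually
    (gt_mem_nhds (by positivity : 0 < δ * t / 4))).exists
  obtain ⟨v, hv⟩ : ∃ v, ε * ‖v‖ < ‖f.comp (ContinuousLinearMap.id ℝ X - b.proj A) v‖ := by
    by_contra! h
    exact (hcon A).not_ge (ContinuousLinearMap.opNorm_le_bound _ hε.le h)
  set w := v - b.proj A v with hw_def
  have hfw : ε * ‖v‖ < |f w| := hv
  have hwA : ∀ i ∈ A, b.coord i w = 0 := by
    intro i hi
    simp [hw_def, b.ortho, Pi.single_apply, hi]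
  have hw0 : w ≠ 0 := by
    rintro h
    rw [h, map_zero, abs_zero] at hfw
    exact hfw.not_ge (by positivity)
  have hpw : 0 < p w := lt_of_lt_of_le (mul_pos hc (norm_pos_iff.2 hw0)) (hcC w).1
  have hpw' : p w ≤ C * (1 + K) * ‖v‖ := by
    refine (hcC w).2.trans ?_
    rw [mul_assoc]
    gcongr
    calc ‖w‖ ≤ ‖v‖ + ‖b.proj A v‖ := norm_sub_le _ _
      _ ≤ ‖v‖ + K * ‖v‖ := by gcongr; exact (b.proj A).le_of_opNorm_le (hK A) v
      _ = _ := by ring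
  set h := (p w)⁻¹ • w with hh_def
  have hph : p h = 1 := by
    rw [hh_def, map_smul_eq_mul, norm_inv, Real.norm_of_nonneg hpw.le, inv_mul_cancel₀ hpw.ne']
  have hhA : ∀ i ∈ A, b.coord i h = 0 := fun i hi => by rw [hh_def, map_smul, hwA i hi, smul_zero]
  have hRh : δ ≤ R h := by
    refine le_trans ?_ (hRf h)
    rw [hh_def, map_smul, smul_eq_mul, abs_mul, abs_inv, abs_of_pos hpw, hδ_def,
      ← div_eq_inv_mul, div_le_div_iff₀ (by positivity) hpw]
    calc ε * p w ≤ ε * (C * (1 + K) * ‖v‖) := by gcongr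
      _ = ε * ‖v‖ * (C * (1 + K)) := by ring
      _ ≤ _ := by gcongr
  have hlow : ∀ s : ℝ, |s| = t → R x + t * δ - δ * t / 2 ≤ R (x + s • h) := by
    intro s hst
    have hind : Summable fun i => if i ∈ A then 0 else |b.coord i x * f (b i)| := by
      refine Summable.of_nonneg_of_le (fun i => ?_) (fun i => ?_) (hsum x)
      · split_ifs
        exacts [le_rfl, abs_nonneg _]
      · split_ifs
        exacts [abs_nonneg _, le_rfl]
    have htail : ∑' i, (if i ∈ A then 0 else |b.coord i x * f (b i)|) < δ * t / 4 := by
      refine lt_of_eq_of_lt ((tsum_congr fun i => ?_).trans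
        (tsum_subtype ((A : Set Γ)ᶜ) fun i => |b.coord i x * f (b i)|).symm) hA
      by_cases hi : i ∈ A <;> simp [hi]
    -- Termwise: on `A` the vector `h` vanishes, and off `A` the triangle inequality loses twice the
    -- term of `x`.
    have hle : R x + t * R h ≤ R (x + s • h) +
        2 * ∑' i, (if i ∈ A then 0 else |b.coord i x * f (b i)|) := by
      rw [hRdef, hRdef, hRdef, ← tsum_mul_left, ← tsum_mul_left,
        ← (hsum x).tsum_add ((hsum h).mul_left t), ← (hsum _).tsum_add (hind.mul_left 2)]
      refine ((hsum x).add ((hsum h).mul_left t)).tsum_le_tsum (fun i => ?_)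
        ((hsum _).add (hind.mul_left 2))
      by_cases hi : i ∈ A
      · simp [hi, hhA i hi]
      · simp only [hi, if_false, map_add, map_smul, smul_eq_mul]
        have h1 : t * |b.coord i h * f (b i)| = |s * b.coord i h * f (b i)| := by
          rw [mul_assoc, abs_mul s, hst]
        have h2 := abs_sub_abs_le_abs_sub (s * b.coord i h * f (b i)) (-(b.coord i x * f (b i)))
        rw [abs_neg, sub_neg_eq_add] at h2
        rw [h1, add_mul, add_comm (b.coord i x * f (b i))]
        linarith
    have := mul_le_mul_of_nonneg_left hRh ht.le
    linarith
  have h1 := hlow t (abs_of_pos ht)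
  have h2 := hlow (-t) (by rw [abs_neg, abs_of_pos ht])
  rw [neg_smul, ← sub_eq_add_neg] at h2
  have h3 := hx h hph
  linarith

end GeneralSchauderBasis

/-! ### Quadratic gauges and dual norms -/

section Gauge

variable {X : Type*} [NormedAddCommGroup X] [NormedSpace ℝ X]

/-- A quadratic gauge on the dual: a nonnegative, convex, `2`-homogeneous, weak-star lower
semicontinuous function that is bounded on bounded sets. -/
structure IsQuadraticGauge (φ : StrongDual ℝ X → ℝ) : Prop where
  nonneg : ∀ f, 0 ≤ φ f
  convexOn : ConvexOn ℝ Set.univ φ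
  map_smul : ∀ (a : ℝ) f, φ (a • f) = a ^ 2 * φ f
  bounded : ∃ M, 0 ≤ M ∧ ∀ f, φ f ≤ M * ‖f‖ ^ 2
  lsc : LowerSemicontinuous fun f : WeakDual ℝ X => φ (WeakDual.toStrongDual f)

/-- A uniformly bounded supremum of quadratic gauges is a quadratic gauge. -/
theorem IsQuadraticGauge.iSup {ι : Type*} {φ : ι → StrongDual ℝ X → ℝ}
    (hφ : ∀ i, IsQuadraticGauge (φ i)) {M : ℝ} (hM0 : 0 ≤ M)
    (hM : ∀ i f, φ i f ≤ M * ‖f‖ ^ 2) : IsQuadraticGauge fun f => ⨆ i, φ i f := by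
  have hbdd : ∀ f, BddAbove (Set.range fun i => φ i f) := fun f =>
    ⟨M * ‖f‖ ^ 2, by rintro _ ⟨i, rfl⟩; exact hM i f⟩
  have hnn : ∀ f, 0 ≤ ⨆ i, φ i f := fun f => Real.iSup_nonneg fun i => (hφ i).nonneg f
  refine ⟨hnn, ⟨convex_univ, fun f _ g _ a b ha hb hab => ?_⟩, fun a f => ?_, ⟨M, hM0, fun f => ?_⟩,
    lowerSemicontinuous_ciSup (fun f => hbdd (WeakDual.toStrongDual f)) fun i => (hφ i).lsc⟩
  · simp only [smul_eq_mul]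
    -- The index type may be empty, the supremum then being 0, so the bound must also be shown
    -- nonnegative.
    refine Real.iSup_le (fun i => ((hφ i).convexOn.2 trivial trivial ha hb hab).trans ?_)
      (add_nonneg (mul_nonneg ha (hnn f)) (mul_nonneg hb (hnn g)))
    simp only [smul_eq_mul]
    gcongr
    exacts [le_ciSup (hbdd f) i, le_ciSup (hbdd g) i]
  · simp only [(hφ _).map_smul]
    rw [Real.mul_iSup_of_nonneg (sq_nonneg a)]
  · exact Real.iSup_le (fun i => hM i f) (by positivity)

/-- A suitable weighted sum of a sequence of quadratic gauges is a quadratic gauge. -/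
theorem IsQuadraticGauge.exists_tsum {W : ℕ → StrongDual ℝ X → ℝ}
    (hW : ∀ j, IsQuadraticGauge (W j)) :
    ∃ w : ℕ → ℝ, (∀ j, 0 < w j) ∧ (∀ f, Summable fun j => w j * W j f) ∧
      IsQuadraticGauge fun f => ∑' j, w j * W j f := by
  choose M hM0 hM using fun j => (hW j).bounded
  have hw : ∀ j, 0 < (1 / 2 : ℝ) ^ j / (1 + M j) := fun j => by
    have := hM0 j
    positivity
  have hnn : ∀ f j, 0 ≤ (1 / 2 : ℝ) ^ j / (1 + M j) * W j f := fun f j =>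
    mul_nonneg (hw j).le ((hW j).nonneg f)
  have hle : ∀ f j, (1 / 2 : ℝ) ^ j / (1 + M j) * W j f ≤ (1 / 2 : ℝ) ^ j * ‖f‖ ^ 2 := by
    intro f j
    have h0 := hM0 j
    calc (1 / 2 : ℝ) ^ j / (1 + M j) * W j f
        ≤ (1 / 2 : ℝ) ^ j / (1 + M j) * ((1 + M j) * ‖f‖ ^ 2) := by
          gcongr
          exact (hM j f).trans (by gcongr; linarith)
      _ = _ := by field_simp
  have hgeo : ∀ f : StrongDual ℝ X, Summable fun j : ℕ => (1 / 2 : ℝ) ^ j * ‖f‖ ^ 2 := fun f =>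
    (summable_geometric_of_lt_one (by norm_num) (by norm_num)).mul_right _
  have hsum : ∀ f, Summable fun j => (1 / 2 : ℝ) ^ j / (1 + M j) * W j f := fun f =>
    (hgeo f).of_nonneg_of_le (hnn f) (hle f)
  refine ⟨_, hw, hsum, fun f => tsum_nonneg (hnn f),
    ⟨convex_univ, fun f _ g _ a b ha hb hab => ?_⟩, fun a f => ?_, ⟨2, two_pos.le, fun f => ?_⟩, ?_⟩
  · simp only [smul_eq_mul]
    rw [← tsum_mul_left, ← tsum_mul_left, ← ((hsum f).mul_left a).tsum_add ((hsum g).mul_left b)]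
    refine (hsum _).tsum_le_tsum (fun j => ?_) (((hsum f).mul_left a).add ((hsum g).mul_left b))
    have h1 := mul_le_mul_of_nonneg_left
      ((hW j).convexOn.2 (Set.mem_univ f) (Set.mem_univ g) ha hb hab) (hw j).le
    simp only [smul_eq_mul] at h1
    linarith
  · rw [← tsum_mul_left]
    exact tsum_congr fun j => by rw [(hW j).map_smul]; ring
  · refine ((hsum f).tsum_le_tsum (hle f) (hgeo f)).trans_eq ?_
    rw [tsum_mul_right, tsum_geometric_two]
  · rw [lowerSemicontinuous_iff_isClosed_preimage]
    intro r
    -- The terms are nonnegative, so a sublevel set of the series is the intersection of those of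
    -- its finite partial sums.
    have heq : (fun f : WeakDual ℝ X => ∑' j, (1 / 2 : ℝ) ^ j / (1 + M j) *
        W j (WeakDual.toStrongDual f)) ⁻¹' Set.Iic r = ⋂ s : Finset ℕ,
        (fun f : WeakDual ℝ X => ∑ j ∈ s, (1 / 2 : ℝ) ^ j / (1 + M j) *
          W j (WeakDual.toStrongDual f)) ⁻¹' Set.Iic r := by
      ext f
      simp only [Set.mem_preimage, Set.mem_Iic, Set.mem_iInter]
      exact ⟨fun h s => ((hsum _).sum_le_tsum s fun j _ => hnn _ j).trans h,
        fun h => (hsum _).tsum_le_of_sum_le h⟩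
    rw [heq]
    refine isClosed_iInter fun s => LowerSemicontinuous.isClosed_preimage
      (lowerSemicontinuous_sum fun j _ => ?_) r
    exact (continuous_const_mul ((1 / 2 : ℝ) ^ j / (1 + M j))).comp_lowerSemicontinuous
      (hW j).lsc (monotone_mul_left_of_nonneg (hw j).le)

/-- A coercive quadratic gauge is the square of the dual norm of an equivalent norm. -/
theorem IsQuadraticGauge.exists_dualNorm_sq {Θ : StrongDual ℝ X → ℝ} (hΘ : IsQuadraticGauge Θ)
    {c : ℝ} (hc : 0 < c) (hcΘ : ∀ f, c * ‖f‖ ^ 2 ≤ Θ f) :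
    ∃ q : Seminorm ℝ X, IsEquivalentNorm q ∧ ∀ f, 0 ≤ dualNorm q f ∧ dualNorm q f ^ 2 = Θ f := by
  obtain ⟨M, hM0, hM⟩ := hΘ.bounded
  have hball : ∀ f, Θ f ≤ 1 → ‖f‖ ≤ 1 / √c := by
    intro f hf
    rw [← Real.sqrt_one, ← Real.sqrt_div zero_le_one]
    refine Real.le_sqrt_of_sq_le ?_
    rw [le_div_iff₀ hc, mul_comm]
    exact (hcΘ f).trans hf
  have hbound : ∀ x f, Θ f ≤ 1 → |f x| ≤ 1 / √c * ‖x‖ := fun x f hf =>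
    f.le_of_opNorm_le (hball f hf) x
  have hbdd : ∀ x, BddAbove (Set.range fun f : {f // Θ f ≤ 1} => |f.1 x|) := fun x =>
    ⟨1 / √c * ‖x‖, by rintro _ ⟨f, rfl⟩; exact hbound x f.1 f.2⟩
  -- `q` is the support function of `{Θ ≤ 1}`; that its dual unit ball is again this set is the
  -- bipolar theorem.
  let q : Seminorm ℝ X := Seminorm.of (fun x => ⨆ f : {f // Θ f ≤ 1}, |f.1 x|)
    (fun x y => Real.iSup_le (fun f => by
      rw [map_add]
      exact (abs_add_le _ _).trans (add_le_add (le_ciSup (hbdd x) f) (le_ciSup (hbdd y) f)))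
      (add_nonneg (Real.iSup_nonneg fun _ => abs_nonneg _)
        (Real.iSup_nonneg fun _ => abs_nonneg _)))
    (fun a x => by
      rw [Real.norm_eq_abs, Real.mul_iSup_of_nonneg (abs_nonneg a)]
      simp [abs_mul])
  have hq : ∀ x f, Θ f ≤ 1 → |f x| ≤ q x := fun x f hf => le_ciSup (hbdd x) ⟨f, hf⟩
  have hq' : ∀ x r, 0 ≤ r → (∀ f, Θ f ≤ 1 → |f x| ≤ r) → q x ≤ r := fun x r hr h =>
    Real.iSup_le (fun f => h f.1 f.2) hr
  have hc' : 0 < √c := Real.sqrt_pos.2 hc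
  have hM' : 0 < √(M + 1) := Real.sqrt_pos.2 (by positivity)
  refine ⟨q, ⟨1 / √(M + 1), 1 / √c, by positivity, by positivity, fun x =>
    ⟨?_, hq' x _ (by positivity) (hbound x)⟩⟩, fun f => ?_⟩
  · obtain ⟨g, hg, hgx⟩ := exists_dual_vector'' ℝ x
    have h1 : Θ ((1 / √(M + 1)) • g) ≤ 1 := by
      rw [hΘ.map_smul, div_pow, Real.sq_sqrt (by positivity), one_pow, one_div,
        inv_mul_le_iff₀ (by positivity)]
      calc Θ g ≤ M * ‖g‖ ^ 2 := hM g
        _ ≤ M * 1 ^ 2 := by gcongr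
        _ ≤ _ := by linarith
    refine le_trans ?_ (hq x _ h1)
    simp [hgx, abs_mul, abs_of_pos hM']
  have hsqrt : dualNorm q f = √(Θ f) := by
    have hmul : ∀ x, |f x| ≤ √(Θ f) * q x := by
      intro x
      rcases (hΘ.nonneg f).eq_or_lt with h0 | h0
      · have h1 : ‖f‖ ^ 2 ≤ 0 := by
          have := hcΘ f
          rw [← h0] at this
          exact nonpos_of_mul_nonpos_right this hc
        have h2 : f = 0 := by simpa using le_antisymm h1 (sq_nonneg _)
        simp only [h2, zero_apply, abs_zero]
        exact mul_nonneg (Real.sqrt_nonneg _) (apply_nonneg q x)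
      · have hs : 0 < √(Θ f) := Real.sqrt_pos.2 h0
        have h1 : Θ ((√(Θ f))⁻¹ • f) ≤ 1 := by
          rw [hΘ.map_smul, inv_pow, Real.sq_sqrt h0.le, inv_mul_cancel₀ h0.ne']
        have h2 := hq x _ h1
        rw [smul_apply, smul_eq_mul, abs_mul, abs_inv, abs_of_pos hs,
          inv_mul_le_iff₀ hs] at h2
        exact h2
    have hub : ∀ r ∈ {r : ℝ | ∃ x : X, q x ≤ 1 ∧ r = |f x|}, r ≤ √(Θ f) := by
      rintro _ ⟨x, hx, rfl⟩
      exact (hmul x).trans (mul_le_of_le_one_right (Real.sqrt_nonneg _) hx)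
    have hne : {r : ℝ | ∃ x : X, q x ≤ 1 ∧ r = |f x|}.Nonempty := ⟨0, 0, by simp, by simp⟩
    have hdn : 0 ≤ dualNorm q f := Real.sSup_nonneg (by rintro _ ⟨x, -, rfl⟩; exact abs_nonneg _)
    refine le_antisymm (csSup_le hne hub) (le_of_forall_gt_imp_ge_of_dense fun r hr => ?_)
    by_contra! hrf
    have hr0 : 0 < r := hdn.trans_lt hr
    have hr1 : 1 < Θ (r⁻¹ • f) := by
      rw [hΘ.map_smul, inv_pow, ← div_eq_inv_mul, one_lt_div (by positivity)]
      exact (Real.lt_sqrt hr0.le).1 hrf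
    have : LocallyConvexSpace ℝ (WeakDual ℝ X) := (WeakDual.withSeminorms ℝ X).toLocallyConvexSpace
    have hconv : Convex ℝ {g : WeakDual ℝ X | Θ (WeakDual.toStrongDual g) ≤ 1} := by
      intro g hg h hh a b ha hb hab
      have h1 := hΘ.convexOn.2 (Set.mem_univ (WeakDual.toStrongDual g))
        (Set.mem_univ (WeakDual.toStrongDual h)) ha hb hab
      simp only [smul_eq_mul] at h1
      have hg : Θ (WeakDual.toStrongDual g) ≤ 1 := hg
      have hh : Θ (WeakDual.toStrongDual h) ≤ 1 := hh
      change Θ (WeakDual.toStrongDual (a • g + b • h)) ≤ 1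
      rw [map_add, _root_.map_smul, _root_.map_smul]
      nlinarith
    obtain ⟨φ, s, hφs, hsφ⟩ := geometric_hahn_banach_closed_point hconv
      (hΘ.lsc.isClosed_preimage 1) (x := StrongDual.toWeakDual (r⁻¹ • f)) hr1.not_ge
    -- Weak-star continuous functionals are evaluations, so the separation takes place at a point of
    -- `X`.
    obtain ⟨x, rfl⟩ := LinearMap.dualEmbedding_surjective (topDualPairing ℝ X) φ
    have hs : ∀ g : StrongDual ℝ X, Θ g ≤ 1 → g x < s := fun g hg =>
      hφs (StrongDual.toWeakDual g) hg
    have hsf : s < r⁻¹ * f x := hsφ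
    have hs0 : 0 < s := by
      have h0 := hs 0 (by simpa using (hM 0).trans (by simp))
      simpa using h0
    have hqx : q x ≤ s := hq' x s hs0.le fun g hg => abs_le.2
      ⟨by
        have h1 := hs ((-1 : ℝ) • g) (by rw [hΘ.map_smul]; simpa using hg)
        simp at h1
        linarith, (hs g hg).le⟩
    have h1 : |f (s⁻¹ • x)| ≤ dualNorm q f := by
      refine le_csSup ⟨_, hub⟩ ⟨s⁻¹ • x, ?_, rfl⟩
      rw [map_smul_eq_mul, norm_inv, Real.norm_of_nonneg hs0.le, inv_mul_le_iff₀ hs0, mul_one]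
      exact hqx
    have h2 : r < |f (s⁻¹ • x)| := by
      rw [_root_.map_smul, smul_eq_mul]
      refine lt_of_lt_of_le ?_ (le_abs_self _)
      rw [← div_eq_inv_mul, lt_div_iff₀ hr0] at hsf
      rw [← div_eq_inv_mul, lt_div_iff₀ hs0]
      linarith
    linarith
  rw [hsqrt]
  exact ⟨Real.sqrt_nonneg _, Real.sq_sqrt (hΘ.nonneg f)⟩

/-- A sequence of quadratic gauges, the first of which is coercive, gives an equivalent norm such
that sequences as in the definition of local uniform rotundity asymptotically attain equality in
the midpoint convexity of every gauge of the sequence. -/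
theorem exists_equivalentNorm_tendsto_gauge {W : ℕ → StrongDual ℝ X → ℝ}
    (hW : ∀ j, IsQuadraticGauge (W j)) (hW0 : ∀ f, ‖f‖ ^ 2 ≤ W 0 f) :
    ∃ q : Seminorm ℝ X, IsEquivalentNorm q ∧
      (∃ C, ∀ f, 0 ≤ dualNorm q f ∧ dualNorm q f ≤ C * ‖f‖) ∧
      ∀ (f : StrongDual ℝ X) (u : ℕ → StrongDual ℝ X), dualNorm q f = 1 →
        (∀ n, dualNorm q (u n) = 1) → Tendsto (fun n => dualNorm q (f + u n)) atTop (𝓝 2) →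
        ∀ j, Tendsto (fun n => (W j f + W j (u n)) / 2 - W j ((1 / 2 : ℝ) • (f + u n)))
          atTop (𝓝 0) := by
  obtain ⟨w, hw, hsum, hΘ⟩ := IsQuadraticGauge.exists_tsum hW
  have hnn : ∀ f j, 0 ≤ w j * W j f := fun f j => mul_nonneg (hw j).le ((hW j).nonneg f)
  obtain ⟨q, hq, hqΘ⟩ := hΘ.exists_dualNorm_sq (hw 0) fun f =>
    (mul_le_mul_of_nonneg_left (hW0 f) (hw 0).le).trans
      ((hsum f).le_tsum 0 fun j _ => hnn f j)
  obtain ⟨M, hM0, hM⟩ := hΘ.bounded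
  refine ⟨q, hq, ⟨√M, fun f => ⟨(hqΘ f).1, ?_⟩⟩, fun f u hf hu hfu j => ?_⟩
  · refine le_of_sq_le_sq ?_ (by positivity)
    rw [(hqΘ f).2, mul_pow, Real.sq_sqrt hM0]
    exact hM f
  · have hmid : ∀ j g, 0 ≤ (W j f + W j g) / 2 - W j ((1 / 2 : ℝ) • (f + g)) := by
      intro j g
      have h1 := (hW j).convexOn.2 (Set.mem_univ f) (Set.mem_univ g)
        (by norm_num : (0 : ℝ) ≤ 1 / 2) (by norm_num : (0 : ℝ) ≤ 1 / 2) (by norm_num)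
      simp only [smul_eq_mul, ← smul_add] at h1
      linarith
    have hle : ∀ n, (W j f + W j (u n)) / 2 - W j ((1 / 2 : ℝ) • (f + u n)) ≤
        (w j)⁻¹ * (1 - (1 / 2) ^ 2 * dualNorm q (f + u n) ^ 2) := by
      intro n
      -- The convexity defect of the whole sum is the weighted sum of nonnegative defects, so it
      -- dominates each of them.
      have hs : HasSum (fun i => w i * ((W i f + W i (u n)) / 2 - W i ((1 / 2 : ℝ) • (f + u n))))
          ((∑' i, w i * W i f + ∑' i, w i * W i (u n)) / 2 -
            ∑' i, w i * W i ((1 / 2 : ℝ) • (f + u n))) := by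
        convert! (((hsum f).hasSum.add (hsum (u n)).hasSum).div_const 2).sub
          (hsum ((1 / 2 : ℝ) • (f + u n))).hasSum using 2
        ring
      have h1 := le_hasSum hs j fun i _ => mul_nonneg (hw i).le (hmid i (u n))
      have h2 := hΘ.map_smul (1 / 2) (f + u n)
      beta_reduce at h2
      rw [h2, ← (hqΘ f).2, ← (hqΘ (u n)).2, ← (hqΘ (f + u n)).2, hf, hu] at h1
      rw [← div_eq_inv_mul, le_div_iff₀ (hw j)]
      linarith
    have hlim : Tendsto (fun n => (w j)⁻¹ * (1 - (1 / 2) ^ 2 * dualNorm q (f + u n) ^ 2)) atTop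
        (𝓝 ((w j)⁻¹ * (1 - (1 / 2) ^ 2 * 2 ^ 2))) :=
      (((hfu.pow 2).const_mul _).const_sub _).const_mul _
    refine squeeze_zero (fun n => hmid j (u n)) hle ?_
    convert hlim using 2
    norm_num

end Gauge

/-! ### Gauges built from finite sets of basis vectors -/

namespace GeneralSchauderBasis

variable {X : Type*} [NormedAddCommGroup X] [NormedSpace ℝ X] {Γ : Type*}

/-- The complementary projection of `b.proj A`. -/
noncomputable def coproj (b : UnconditionalSchauderBasis Γ ℝ X) (A : Finset Γ) : X →L[ℝ] X :=
  ContinuousLinearMap.id ℝ X - b.proj A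

/-- The basis vectors scaled to norm one. -/
noncomputable def unit (b : UnconditionalSchauderBasis Γ ℝ X) (i : Γ) : X := ‖b i‖⁻¹ • b i

/-- The quadratic gauge `∑_{i ∈ A} f (e i) ^ 2 + δ ‖f ∘ (1 - P_A)‖ ^ 2` for normalized `e i`. -/
noncomputable def setGauge (b : UnconditionalSchauderBasis Γ ℝ X) (δ : ℝ) (A : Finset Γ)
    (f : StrongDual ℝ X) : ℝ :=
  ∑ i ∈ A, f (b.unit i) ^ 2 + δ * ‖f.comp (b.coproj A)‖ ^ 2

/-- The supremum of the gauges `setGauge b (1 / (k + 1)) A` over all sets `A` with `n` elements. -/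
noncomputable def cardGauge (b : UnconditionalSchauderBasis Γ ℝ X) (n k : ℕ)
    (f : StrongDual ℝ X) : ℝ :=
  ⨆ A : {A : Finset Γ // A.card = n}, b.setGauge (1 / (k + 1)) A.1 f

variable (b : UnconditionalSchauderBasis Γ ℝ X)

theorem basis_ne_zero (i : Γ) : b i ≠ 0 := by
  classical
  intro h
  have := b.ortho i i
  simp [h] at this

theorem norm_unit (i : Γ) : ‖b.unit i‖ = 1 := by
  rw [unit, norm_smul, norm_inv, norm_norm, inv_mul_cancel₀ (norm_ne_zero_iff.2 (b.basis_ne_zero i))]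

theorem apply_basis (f : StrongDual ℝ X) (i : Γ) : f (b i) = ‖b i‖ * f (b.unit i) := by
  rw [unit, map_smul, smul_eq_mul, mul_inv_cancel_left₀ (norm_ne_zero_iff.2 (b.basis_ne_zero i))]

/-- The identity `s a² + t c² - (s a + t c)² = s t (a - c)²` for `s + t = 1`, applied to each
coordinate and, after the triangle inequality, to the tail norms. The surplus term drives the LUR
estimate. -/
theorem setGauge_combo (δ : ℝ) (hδ : 0 ≤ δ) (A : Finset Γ) (f g : StrongDual ℝ X) {s t : ℝ}
    (hs : 0 ≤ s) (ht : 0 ≤ t) (hst : s + t = 1) :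
    b.setGauge δ A (s • f + t • g) + s * t * (∑ i ∈ A, (f - g) (b.unit i) ^ 2 +
      δ * (‖f.comp (b.coproj A)‖ - ‖g.comp (b.coproj A)‖) ^ 2) ≤
    s * b.setGauge δ A f + t * b.setGauge δ A g := by
  obtain rfl : t = 1 - s := by linarith
  have h1 : ∑ i ∈ A, (s • f + (1 - s) • g) (b.unit i) ^ 2 +
      s * (1 - s) * ∑ i ∈ A, (f - g) (b.unit i) ^ 2 =
      s * ∑ i ∈ A, f (b.unit i) ^ 2 + (1 - s) * ∑ i ∈ A, g (b.unit i) ^ 2 := by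
    simp only [Finset.mul_sum, ← Finset.sum_add_distrib]
    refine Finset.sum_congr rfl fun i _ => ?_
    simp only [add_apply, sub_apply, smul_apply, smul_eq_mul]
    ring
  have h2 : ‖(s • f + (1 - s) • g).comp (b.coproj A)‖ ≤
      s * ‖f.comp (b.coproj A)‖ + (1 - s) * ‖g.comp (b.coproj A)‖ := by
    rw [ContinuousLinearMap.add_comp, ContinuousLinearMap.smul_comp, ContinuousLinearMap.smul_comp]
    refine (norm_add_le _ _).trans_eq ?_
    rw [norm_smul, norm_smul, Real.norm_of_nonneg hs, Real.norm_of_nonneg ht]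
  have h3 := pow_le_pow_left₀ (norm_nonneg _) h2 2
  have h4 := mul_le_mul_of_nonneg_left h3 hδ
  simp only [setGauge]
  nlinarith

theorem norm_comp_coproj_le {K : ℝ} (hK : ∀ A, ‖b.proj A‖ ≤ K) (A : Finset Γ)
    (f : StrongDual ℝ X) : ‖f.comp (b.coproj A)‖ ≤ (1 + K) * ‖f‖ := by
  refine (f.opNorm_comp_le _).trans ?_
  rw [mul_comm]
  gcongr
  exact (norm_sub_le _ _).trans (add_le_add ContinuousLinearMap.norm_id_le (hK A))

theorem setGauge_le {K : ℝ} (hK : ∀ A, ‖b.proj A‖ ≤ K) {δ : ℝ} (hδ : δ ≤ 1)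
    (A : Finset Γ) (f : StrongDual ℝ X) :
    b.setGauge δ A f ≤ (A.card + (1 + K) ^ 2) * ‖f‖ ^ 2 := by
  have h1 : ∑ i ∈ A, f (b.unit i) ^ 2 ≤ A.card * ‖f‖ ^ 2 := by
    rw [← nsmul_eq_mul]
    refine Finset.sum_le_card_nsmul _ _ _ fun i _ => ?_
    rw [← sq_abs]
    gcongr
    simpa [b.norm_unit i] using f.le_opNorm (b.unit i)
  have h2 : ‖f.comp (b.coproj A)‖ ^ 2 ≤ (1 + K) ^ 2 * ‖f‖ ^ 2 := by
    rw [← mul_pow]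
    exact pow_le_pow_left₀ (norm_nonneg _) (b.norm_comp_coproj_le hK A f) 2
  have h3 := mul_le_mul_of_nonneg_right hδ (sq_nonneg ‖f.comp (b.coproj A)‖)
  simp only [setGauge]
  linarith

theorem isQuadraticGauge_setGauge {K : ℝ} (hK : ∀ A, ‖b.proj A‖ ≤ K) {δ : ℝ} (hδ0 : 0 ≤ δ)
    (hδ : δ ≤ 1) (A : Finset Γ) : IsQuadraticGauge (b.setGauge δ A) := by
  refine ⟨fun f => ?_, ⟨convex_univ, fun f _ g _ s t hs ht hst => ?_⟩, fun a f => ?_,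
    ⟨_, by positivity, b.setGauge_le hK hδ A⟩, ?_⟩
  · exact add_nonneg (Finset.sum_nonneg fun i _ => sq_nonneg _) (by positivity)
  · refine le_trans (le_add_of_nonneg_right ?_) (b.setGauge_combo δ hδ0 A f g hs ht hst)
    exact mul_nonneg (mul_nonneg hs ht)
      (add_nonneg (Finset.sum_nonneg fun i _ => sq_nonneg _) (by positivity))
  · simp only [setGauge, smul_apply, smul_eq_mul, mul_pow, ContinuousLinearMap.smul_comp,
      norm_smul, Real.norm_eq_abs, sq_abs, ← Finset.mul_sum]
    ring
  · have heval : ∀ x : X, Continuous fun f : WeakDual ℝ X => WeakDual.toStrongDual f x := fun x =>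
      WeakBilin.eval_continuous (topDualPairing ℝ X) x
    have h1 : LowerSemicontinuous fun f : WeakDual ℝ X =>
        ‖(WeakDual.toStrongDual f).comp (b.coproj A)‖ ^ 2 := by
      rw [lowerSemicontinuous_iff_isClosed_preimage]
      intro r
      by_cases hr : 0 ≤ r
      · have heq : (fun f : WeakDual ℝ X =>
            ‖(WeakDual.toStrongDual f).comp (b.coproj A)‖ ^ 2) ⁻¹' Set.Iic r =
            ⋂ x : X, {f | |WeakDual.toStrongDual f (b.coproj A x)| ≤ √r * ‖x‖} := by
          ext f
          simp only [Set.mem_preimage, Set.mem_Iic, Set.mem_iInter, Set.mem_ofPred_eq]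
          rw [← Real.le_sqrt (norm_nonneg _) hr,
            ContinuousLinearMap.opNorm_le_iff (Real.sqrt_nonneg r)]
          rfl
        rw [heq]
        exact isClosed_iInter fun x => isClosed_le (heval _).abs continuous_const
      · convert isClosed_empty using 1
        ext f
        simp only [Set.mem_preimage, Set.mem_Iic, Set.mem_empty_iff_false, iff_false]
        exact fun h => hr ((sq_nonneg _).trans h)
    have h2 : LowerSemicontinuous fun f : WeakDual ℝ X =>
        ∑ i ∈ A, WeakDual.toStrongDual f (b.unit i) ^ 2 :=
      (continuous_finsetSum _ fun i _ => (heval _).pow 2).lowerSemicontinuous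
    exact h2.add ((continuous_const_mul δ).comp_lowerSemicontinuous h1
      (monotone_mul_left_of_nonneg hδ0))

theorem one_div_succ_mem (k : ℕ) : 0 ≤ 1 / ((k : ℝ) + 1) ∧ 1 / ((k : ℝ) + 1) ≤ 1 :=
  ⟨by positivity, by
    rw [div_le_one (by positivity)]
    linarith [k.cast_nonneg (α := ℝ)]⟩

theorem isQuadraticGauge_cardGauge {K : ℝ} (hK : ∀ A, ‖b.proj A‖ ≤ K) (n k : ℕ) :
    IsQuadraticGauge (b.cardGauge n k) :=
  IsQuadraticGauge.iSup (M := n + (1 + K) ^ 2)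
    (fun A : {A : Finset Γ // A.card = n} => b.isQuadraticGauge_setGauge hK (one_div_succ_mem k).1
      (one_div_succ_mem k).2 A.1) (by positivity) fun A f => by
      have := b.setGauge_le hK (one_div_succ_mem k).2 A.1 f
      rwa [A.2] at this

theorem setGauge_le_cardGauge {K : ℝ} (hK : ∀ A, ‖b.proj A‖ ≤ K) {n k : ℕ} {A : Finset Γ}
    (hA : A.card = n) (f : StrongDual ℝ X) :
    b.setGauge (1 / (k + 1)) A f ≤ b.cardGauge n k f := by
  refine le_ciSup (f := fun A : {A : Finset Γ // A.card = n} => b.setGauge (1 / (k + 1)) A.1 f)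
    ⟨(n + (1 + K) ^ 2) * ‖f‖ ^ 2, ?_⟩ ⟨A, hA⟩
  rintro _ ⟨B, rfl⟩
  have := b.setGauge_le hK (one_div_succ_mem k).2 B.1 f
  rwa [B.2] at this

/-- If `f` is large on `A` and small off `A`, then `A` maximizes `∑ f (e i) ^ 2` among the sets of
its cardinality, with a gap. -/
theorem sum_sq_add_gap_le (f : StrongDual ℝ X) {A B : Finset Γ} (hcard : B.card = A.card)
    (hne : B ≠ A) {r s : ℝ} (hr : 0 ≤ r) (hrs : r ≤ s) (hA : ∀ i ∈ A, s ≤ |f (b.unit i)|)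
    (hAc : ∀ i ∉ A, |f (b.unit i)| ≤ r) :
    ∑ i ∈ B, f (b.unit i) ^ 2 + (s ^ 2 - r ^ 2) ≤ ∑ i ∈ A, f (b.unit i) ^ 2 := by
  classical
  have hc : (A \ B).card = (B \ A).card := by
    have h1 := Finset.card_sdiff_add_card_inter A B
    have h2 := Finset.card_sdiff_add_card_inter B A
    rw [Finset.inter_comm] at h2
    omega
  have hpos : 1 ≤ (A \ B).card := by
    rw [Nat.one_le_iff_ne_zero, Finset.card_ne_zero, Finset.sdiff_nonempty]
    exact fun h => hne (Finset.eq_of_subset_of_card_le h hcard.le).symm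
  have h1 : (A \ B).card • s ^ 2 ≤ ∑ i ∈ A \ B, f (b.unit i) ^ 2 :=
    Finset.card_nsmul_le_sum _ _ _ fun i hi => by
      rw [← sq_abs (f _)]
      exact pow_le_pow_left₀ (hr.trans hrs) (hA i (Finset.mem_sdiff.1 hi).1) 2
  have h2 : ∑ i ∈ B \ A, f (b.unit i) ^ 2 ≤ (B \ A).card • r ^ 2 :=
    Finset.sum_le_card_nsmul _ _ _ fun i hi => by
      rw [← sq_abs (f _)]
      exact pow_le_pow_left₀ (abs_nonneg _) (hAc i (Finset.mem_sdiff.1 hi).2) 2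
  rw [← Finset.sum_inter_add_sum_sdiff A B, ← Finset.sum_inter_add_sum_sdiff B A,
    Finset.inter_comm B A]
  rw [← hc] at h2
  simp only [nsmul_eq_mul] at h1 h2
  have h3 : (1 : ℝ) ≤ (A \ B).card := by exact_mod_cast hpos
  have h4 : 0 ≤ s ^ 2 - r ^ 2 := sub_nonneg.2 (pow_le_pow_left₀ hr hrs 2)
  nlinarith

/-- A functional is approximated by its restriction to a finite set of basis vectors on which it is
larger, by a gap, than off that set. -/
theorem exists_gap {K : ℝ} (hK : ∀ A, ‖b.proj A‖ ≤ K) {f : StrongDual ℝ X}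
    (hf : ∀ ε > 0, ∃ A, ‖f.comp (b.coproj A)‖ ≤ ε) {ε : ℝ} (hε : 0 < ε) :
    ∃ (A : Finset Γ) (r s : ℝ), 0 ≤ r ∧ r < s ∧ (∀ i ∈ A, s ≤ |f (b.unit i)|) ∧
      (∀ i ∉ A, |f (b.unit i)| ≤ r) ∧ ‖f.comp (b.coproj A)‖ ≤ (1 + K) * ε := by
  classical
  obtain ⟨A₀, hA₀⟩ := hf ε hε
  -- Discarding the zeros of `f` loses nothing and leaves a positive threshold `s` below all
  -- remaining values.
  set A₁ := A₀.filter fun i => f (b.unit i) ≠ 0 with hA₁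
  have h1 : ∀ᶠ s in 𝓝[>] (0 : ℝ), ∀ i ∈ A₁, s ≤ |f (b.unit i)| := by
    rw [Filter.eventually_all_finset]
    exact fun i hi => nhdsWithin_le_nhds
      (Iic_mem_nhds (abs_pos.2 (Finset.mem_filter.1 hi).2))
  obtain ⟨s, hs, hs0⟩ := (h1.and self_mem_nhdsWithin).exists
  have hs0 : 0 < s := hs0
  -- Off `B` all values are at most `s / 2`, so `{|f| ≥ s}` is finite and its complement has
  -- supremum strictly below `s`.
  obtain ⟨B, hB⟩ := hf (s / 2) (by positivity)
  have hBs : ∀ i ∉ B, |f (b.unit i)| ≤ s / 2 := by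
    intro i hi
    have h2 : b.coproj B (b.unit i) = b.unit i := by
      have : b.proj B (b i) = 0 := by rw [b.proj_apply_basis_mem, if_neg hi]
      simp only [coproj, unit, _root_.map_smul, sub_apply, this, ContinuousLinearMap.id_apply,
        sub_zero]
    have h3 := (f.comp (b.coproj B)).le_of_opNorm_le hB (b.unit i)
    rwa [ContinuousLinearMap.comp_apply, h2, b.norm_unit, mul_one] at h3
  set A := B.filter fun i => s ≤ |f (b.unit i)| with hA
  have hmemA : ∀ i, i ∈ A ↔ s ≤ |f (b.unit i)| := by
    intro i
    rw [hA, Finset.mem_filter, and_iff_right_iff_imp]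
    intro h
    by_contra hi
    linarith [hBs i hi]
  have h2 : ∀ᶠ r in 𝓝[<] s, ∀ i ∈ B \ A, |f (b.unit i)| ≤ r := by
    rw [Filter.eventually_all_finset]
    intro i hi
    rw [Finset.mem_sdiff, hmemA, not_le] at hi
    exact nhdsWithin_le_nhds (Ici_mem_nhds hi.2)
  have h3 : ∀ᶠ r in 𝓝[<] s, s / 2 ≤ r := nhdsWithin_le_nhds (Ici_mem_nhds (by linarith))
  obtain ⟨r, ⟨hr1, hr2⟩, hrs⟩ := ((h2.and h3).and self_mem_nhdsWithin).exists
  refine ⟨A, r, s, by linarith, hrs, fun i hi => (hmemA i).1 hi, fun i hi => ?_, ?_⟩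
  · by_cases hiB : i ∈ B
    · exact hr1 i (Finset.mem_sdiff.2 ⟨hiB, hi⟩)
    · exact (hBs i hiB).trans hr2
  · have hsub : A₁ ⊆ A := fun i hi => (hmemA i).2 (hs i hi)
    have heq : f.comp (b.coproj A) = (f.comp (b.coproj A₀)).comp (b.coproj A) := by
      ext x
      have h4 : ∀ y, f (b.proj A₀ y) = f (b.proj A₁ y) := by
        intro y
        simp only [proj_apply, map_sum, _root_.map_smul, smul_eq_mul]
        rw [hA₁, Finset.sum_filter_of_ne]
        intro i _ hi h0
        rw [b.apply_basis, h0] at hi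
        simp at hi
      have h5 : b.proj A₁ (b.proj A x) = b.proj A₁ x := by
        rw [b.proj_comp]
        congr 2
        rw [Finset.inter_eq_left.2 hsub]
      simp only [ContinuousLinearMap.comp_apply, coproj, sub_apply, ContinuousLinearMap.id_apply,
        map_sub, h4, h5]
      ring
    rw [heq]
    refine (b.norm_comp_coproj_le hK A _).trans ?_
    have : 0 ≤ K := (norm_nonneg _).trans (hK ∅)
    gcongr

/-- If the midpoint convexity inequalities for all gauges `cardGauge` at `f` and `u m` become
equalities in the limit, then `u m` tends to `f`. -/
theorem tendsto_norm_sub_of_cardGauge {K : ℝ} (hK : ∀ A, ‖b.proj A‖ ≤ K) {f : StrongDual ℝ X}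
    (hf : ∀ ε > 0, ∃ A, ‖f.comp (b.coproj A)‖ ≤ ε) {u : ℕ → StrongDual ℝ X}
    (hu : ∀ n k, Tendsto (fun m => (b.cardGauge n k f + b.cardGauge n k (u m)) / 2 -
      b.cardGauge n k ((1 / 2 : ℝ) • (f + u m))) atTop (𝓝 0)) :
    Tendsto (fun m => ‖f - u m‖) atTop (𝓝 0) := by
  have hK0 : 0 ≤ K := (norm_nonneg _).trans (hK ∅)
  suffices h : ∀ ε > 0, ∀ᶠ m in atTop, ‖f - u m‖ ≤ (2 * (1 + K) + 2) * ε by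
    refine Metric.tendsto_nhds.2 fun ε hε => ?_
    have hpos : 0 < 2 * (1 + K) + 2 := by positivity
    filter_upwards [h (ε / 2 / (2 * (1 + K) + 2)) (by positivity)] with m hm
    rw [mul_div_cancel₀ _ hpos.ne'] at hm
    rw [dist_zero_right, norm_norm]
    linarith
  intro ε hε
  obtain ⟨A, r, s, hr, hrs, hA, hAc, hfA⟩ := b.exists_gap hK hf hε
  have hgap : 0 < s ^ 2 - r ^ 2 := sub_pos.2 (pow_lt_pow_left₀ hrs hr two_ne_zero)
  -- The tail term of the gauge must not outweigh the gap: with this `k` it stays below half of it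
  -- for every set.
  obtain ⟨k, hk⟩ := exists_nat_one_div_lt
    (show 0 < (s ^ 2 - r ^ 2) / (2 * (((1 + K) * ‖f‖) ^ 2 + 1)) by positivity)
  set δ : ℝ := 1 / ((k : ℝ) + 1) with hδ
  have hδ0 : 0 < δ := by positivity
  have hδf : ∀ B, δ * ‖f.comp (b.coproj B)‖ ^ 2 < (s ^ 2 - r ^ 2) / 2 := by
    intro B
    have h1 := pow_le_pow_left₀ (norm_nonneg _) (b.norm_comp_coproj_le hK B f) 2
    rw [lt_div_iff₀ (by positivity)] at hk
    nlinarith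
  set L : ℝ := ∑ i ∈ A, ‖b i‖ * ‖b.coord i‖ with hL
  have hL0 : 0 ≤ L := Finset.sum_nonneg fun i _ => by positivity
  -- With a defect below `η` and a set within `η` of the supremum, the surplus is below `8 * η` and
  -- the gauge of that set at `f` is within `4 * η` of `cardGauge`.
  obtain ⟨η, hη0, hη1, hη2, hη3⟩ : ∃ η : ℝ, 0 < η ∧ η ≤ (s ^ 2 - r ^ 2) / 8 ∧
      8 * η ≤ δ * ε ^ 2 ∧ 8 * η ≤ (ε / (L + 1)) ^ 2 := by
    refine ⟨min ((s ^ 2 - r ^ 2) / 8) (min (δ * ε ^ 2 / 8) ((ε / (L + 1)) ^ 2 / 8)), ?_,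
      min_le_left _ _, ?_, ?_⟩
    · refine lt_min (by positivity) (lt_min (by positivity) (by positivity))
    · linarith [(min_le_right ((s ^ 2 - r ^ 2) / 8) _).trans
        (min_le_left (δ * ε ^ 2 / 8) ((ε / (L + 1)) ^ 2 / 8))]
    · linarith [(min_le_right ((s ^ 2 - r ^ 2) / 8) _).trans
        (min_le_right (δ * ε ^ 2 / 8) ((ε / (L + 1)) ^ 2 / 8))]
  filter_upwards [(hu A.card k).eventually (gt_mem_nhds hη0)] with m hm
  set v := u m with hv
  have : Nonempty {B : Finset Γ // B.card = A.card} := ⟨⟨A, rfl⟩⟩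
  obtain ⟨⟨B, hB⟩, hBm⟩ := exists_lt_of_lt_ciSup
    (show b.cardGauge A.card k ((1 / 2 : ℝ) • (f + v)) - η <
      ⨆ B : {B : Finset Γ // B.card = A.card}, b.setGauge (1 / (k + 1)) B.1
        ((1 / 2 : ℝ) • (f + v)) from sub_lt_self _ hη0)
  simp only [← hδ] at hBm
  have hBf := b.setGauge_le_cardGauge hK (k := k) hB f
  have hBv := b.setGauge_le_cardGauge hK (k := k) hB v
  have hAf := b.setGauge_le_cardGauge hK (k := k) rfl f (A := A)
  rw [← hδ] at hBf hBv hAf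
  have hcombo := b.setGauge_combo δ hδ0.le B f v (by norm_num : (0 : ℝ) ≤ 1 / 2)
    (by norm_num : (0 : ℝ) ≤ 1 / 2) (by norm_num)
  rw [← smul_add] at hcombo
  have hsq : 0 ≤ ∑ i ∈ B, (f - v) (b.unit i) ^ 2 := Finset.sum_nonneg fun i _ => sq_nonneg _
  have hsq' : 0 ≤ δ * (‖f.comp (b.coproj B)‖ - ‖v.comp (b.coproj B)‖) ^ 2 := by positivity
  -- Another set would lose the full gap at `f` and regain less than half of it from its tail term.
  have hBA : B = A := by
    by_contra hne
    have h1 := b.sum_sq_add_gap_le f hB hne hr hrs.le hA hAc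
    have h2 := hδf B
    have h3 : 0 ≤ δ * ‖f.comp (b.coproj A)‖ ^ 2 := by positivity
    simp only [setGauge] at hBf hAf hcombo hBm hBv
    linarith
  subst hBA
  have h1 : ‖v.comp (b.coproj B)‖ ≤ ‖f.comp (b.coproj B)‖ + ε := by
    have h2 : (‖f.comp (b.coproj B)‖ - ‖v.comp (b.coproj B)‖) ^ 2 ≤ ε ^ 2 := by
      refine le_of_mul_le_mul_left ?_ hδ0
      linarith
    linarith [(abs_le.1 (abs_le_of_sq_le_sq h2 hε.le)).1]
  have h2 : ∀ i ∈ B, |(f - v) (b.unit i)| ≤ ε / (L + 1) := by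
    intro i hi
    refine abs_le_of_sq_le_sq ?_ (by positivity)
    have := Finset.single_le_sum (f := fun i => (f - v) (b.unit i) ^ 2)
      (fun i _ => sq_nonneg _) hi
    beta_reduce at this
    linarith
  have h3 : ‖(f - v).comp (b.proj B)‖ ≤ ε := by
    refine ContinuousLinearMap.opNorm_le_bound _ hε.le fun x => ?_
    rw [ContinuousLinearMap.comp_apply, proj_apply, map_sum]
    calc ‖∑ i ∈ B, (f - v) (b.coord i x • b i)‖
        ≤ ∑ i ∈ B, ‖b i‖ * ‖b.coord i‖ * (ε / (L + 1) * ‖x‖) := by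
          refine norm_sum_le_of_le _ fun i hi => ?_
          rw [_root_.map_smul, smul_eq_mul, b.apply_basis, norm_mul, norm_mul, norm_norm]
          calc ‖b.coord i x‖ * (‖b i‖ * ‖(f - v) (b.unit i)‖)
              ≤ ‖b.coord i‖ * ‖x‖ * (‖b i‖ * (ε / (L + 1))) := by
                gcongr
                exacts [(b.coord i).le_opNorm x, h2 i hi]
            _ = _ := by ring
      _ = L / (L + 1) * ε * ‖x‖ := by rw [← Finset.sum_mul, ← hL]; ring
      _ ≤ 1 * ε * ‖x‖ := by
          gcongr
          rw [div_le_one (by positivity)]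
          linarith
      _ = ε * ‖x‖ := by ring
  have hdecomp : f - v = f.comp (b.coproj B) - v.comp (b.coproj B) + (f - v).comp (b.proj B) := by
    ext x
    simp [coproj]
    ring
  rw [hdecomp]
  refine (norm_add_le _ _).trans ?_
  have h4 := norm_sub_le (f.comp (b.coproj B)) (v.comp (b.coproj B))
  linarith

end GeneralSchauderBasis

theorem theorem1p1 {X : Type*} [NormedAddCommGroup X] [NormedSpace ℝ X] [CompleteSpace X]
    {Γ : Type*} (b : UnconditionalSchauderBasis Γ ℝ X)
    (hF : ∃ p : Seminorm ℝ X, IsEquivalentNorm p ∧ IsFrechetSmooth p) :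
    ∃ q : Seminorm ℝ X, IsEquivalentNorm q ∧ IsLUR (dualNorm q) := by
  obtain ⟨p, hp, hs⟩ := hF
  obtain ⟨K, hK⟩ := UnconditionalSchauderBasis.exists_norm_proj_le b
  obtain ⟨q, hq, ⟨C, hC⟩, hW⟩ := exists_equivalentNorm_tendsto_gauge
    (W := fun j => b.cardGauge j.unpair.1 j.unpair.2)
    (fun j => b.isQuadraticGauge_cardGauge hK _ _) fun f => by
      -- Index 0 decodes to `n = k = 0`: only the empty set with weight 1, whose gauge is `‖f‖ ^ 2`.
      refine le_of_eq_of_le ?_ (b.setGauge_le_cardGauge hK (A := ∅) (by simp) f)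
      simp [GeneralSchauderBasis.setGauge, GeneralSchauderBasis.coproj]
  refine ⟨q, hq, fun f u hf hu hfu => ?_⟩
  have h1 := b.tendsto_norm_sub_of_cardGauge hK (f := f) (u := u)
    (fun ε hε => b.exists_norm_sub_comp_proj_le hp hs f hε) fun n k => by
      simpa using hW f u hf hu hfu (Nat.pair n k)
  refine squeeze_zero (fun n => (hC _).1) (fun n => (hC _).2) ?_
  simpa using h1.const_mul C
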